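/- Let $n\ge 1$ and let $X$ be a standard Gaussian random variable. Consider real trigonometric polynomials of degree at most $n$, $$f(x)=\sum_{k=0}^n(a_k\cos kx+b_k\sin kx),\qquad g(x)=\sum_{k=0}^n(c_k\cos kx+d_k\sin kx).$$ Write $P_Y$ for the law of a random variable $Y$ and $\|\cdot\|_{var}$ for the total variation norm of a signed measure, $\|\mu\|_{var}=\sup\sum_i|\mu(A_i)|$ over finite measurable partitions. (1) For every $m$, one has $f^{(l)}(0)=0$ for all $1\le l\le 2m$ if and only if $$\sum_{k=1}^n k^{2i-1}b_k=0\quad\text{and}\quad \sum_{k=1}^n k^{2i}a_k=0\qquad(i=1,\dots,m).$$ For $m=n$ the determinant $\Delta$ of this linear system of $2n$ equations, with the unknowns ordered as $(b_1,\dots,b_n,a_1,\dots,a_n)$ and the equations for the $b_k$ listed first, is $$\Delta=(n!)^3\,W(1,2^2,\dots,n^2)^2\neq 0,$$ where $W$ is the Vandermonde determinant. (2) If $f$ is non-constant, then at no point $x$ do more than $2n-1$ consecutive derivatives, starting with the first, vanish: if $f^{(l)}(x)=0$ for all $1\le l\le m$, then $m\le 2n-1$. (3) If $f$ is non-constant,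 then there is a constant $C_f$ such that $$\|P_{f(X)}-P_{f(X)+u}\|_{var}\le C_f|u|^{1/(2n)}\qquad\text{for all }u\in\mathbb R.$$ (4) Let $f$ and $g$ be non-constant, put $\alpha=1/(2n)$, and let $C_f$ and $C_g$ be any constants with which the inequality in (3) holds for $f$ and for $g$ respectively. Then $$\|P_{f(X)}-P_{g(X)}\|_{var}\le C\,\|f-g\|_\infty^{1/(2n+1)},\qquad C=(C_f+C_g)^{\frac1{\alpha+1}}\Bigl(E|\nu|^\alpha+\sqrt{\pi/2}\Bigr),$$ where $\nu$ is standard Gaussian and $\|f-g\|_\infty=\sup_{x\in\mathbb R}|f(x)-g(x)|$. -/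

import Mathlib

namespace TrigGauss

/-- The trigonometric polynomial `∑_{k=0}^n (a_k cos kx + b_k sin kx)`. -/
noncomputable def trigPoly (n : ℕ) (a b : ℕ → ℝ) (x : ℝ) : ℝ :=
  ∑ k ∈ Finset.range (n + 1), (a k * Real.cos (k * x) + b k * Real.sin (k * x))

/-- `f` is not a constant function. -/
def NonConst (f : ℝ → ℝ) : Prop := ¬ ∃ c : ℝ, ∀ x : ℝ, f x = c

/-- The matrix of the linear system
`∑_{k=1}^n k^(2i-1) b_k = 0`, `∑_{k=1}^n k^(2i) a_k = 0` (`i = 1, …, m`)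
in the unknowns `(b_1, …, b_n, a_1, …, a_n)`. Indices in `Fin` start at `0`. -/
def derivSystem (m n : ℕ) : Matrix (Fin m ⊕ Fin m) (Fin n ⊕ Fin n) ℝ :=
  Matrix.fromBlocks
    (Matrix.of fun i k => (((k : ℕ) : ℝ) + 1) ^ (2 * (i : ℕ) + 1)) 0
    0 (Matrix.of fun i k => (((k : ℕ) : ℝ) + 1) ^ (2 * (i : ℕ) + 2))

/-- The Vandermonde determinant `W(1, 2², …, n²)`. -/
noncomputable def vandermondeSq (n : ℕ) : ℝ :=
  (Matrix.vandermonde fun k : Fin n => (((k : ℕ) : ℝ) + 1) ^ 2).det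

/-- `‖P - Q‖_var`: the total mass of the variation of the signed measure `P - Q`
(so it is at most `2` for probability measures). -/
noncomputable def varDist (P Q : MeasureTheory.Measure ℝ)
    [MeasureTheory.IsFiniteMeasure P] [MeasureTheory.IsFiniteMeasure Q] : ℝ :=
  (P.toSignedMeasure - Q.toSignedMeasure).totalVariation.real Set.univ

/-- `‖P_Y - P_{Y+u}‖_var ≤ C |u|^α` for all real `u`. -/
def ShiftBound {Ω : Type*} [MeasurableSpace Ω] (μ : MeasureTheory.Measure Ω)
    [MeasureTheory.IsFiniteMeasure μ] (Y : Ω → ℝ) (α C : ℝ) : Prop :=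
  ∀ u : ℝ, varDist (μ.map Y) (μ.map fun ω => Y ω + u) ≤ C * |u| ^ α

/-- `‖f - g‖_∞ = sup_x |f x - g x|` (used for bounded functions only). -/
noncomputable def supDist (f g : ℝ → ℝ) : ℝ := ⨆ x : ℝ, |f x - g x|

/-- `(C_f + C_g)^(1/(α+1)) (E|ν|^α + √(π/2))` with `ν` standard Gaussian. -/
noncomputable def boundConst (α Cf Cg : ℝ) : ℝ :=
  (Cf + Cg) ^ (1 / (α + 1)) *
    ((∫ t, |t| ^ α ∂(ProbabilityTheory.gaussianReal 0 1)) + Real.sqrt (Real.pi / 2))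

end TrigGauss


/-!
The total variation distance of two laws is the supremum of `|E h(Y) - E h(Z)|` over bounded
continuous test functions `h` with `‖h‖ ≤ 1`.

*Shift estimate.* Let `H` be the increment of a primitive of `h` over `[y, y + u]`, so that
`|H| ≤ ‖h‖ |u|` and `(H ∘ f)' = (h (f + u) - h f) f'`. Since one cannot divide by `f'`, split
`1 = f' W + δ² / (f'² + δ²)` with the regularised quotient `W = f' / (f'² + δ²)`. Gaussian
integration by parts bounds the first part by `‖h‖ |u| (∫ |f''| / (f'² + δ²) + O(1 / δ))`. Near a
point `f'` is either identically zero or injective on each side, and the substitution `y = f' x`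
turns this integral into at most a multiple of `∫ dy / (y² + δ²) = π / δ`. If the zeros of `f'` have
order at most `N`, then locally `|f' x| ≥ c |x - x₀| ^ N`, hence
`∫ δ² / (f'² + δ²) = O(δ ^ (1 / N))`. Compactness, periodicity and the decay of the Gaussian density
globalise both bounds.

*Order of the zeros.* The derivatives of `f` at `0` of orders `1, …, 2n` are Vandermonde-type linear
forms in the coefficients; as translations preserve trigonometric polynomials of degree `n`, the
invertibility of that system gives `N = 2n - 1` at every point.

*Distance estimate.* Add `ε ν` to both variables, with `ν` an independent standard Gaussian: by the
shift estimates this moves each law by `O(ε ^ α)`, while the smoothed laws differ by at most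
`‖f - g‖_∞ / ε`. Then optimise over `ε`.
-/

namespace TrigGauss

open MeasureTheory ProbabilityTheory BoundedContinuousFunction Filter Set Topology
open scoped ENNReal NNReal Real

section TrigPoly

variable {n : ℕ} {a b : ℕ → ℝ}

theorem hasDerivAt_trigPoly (n : ℕ) (a b : ℕ → ℝ) (x : ℝ) :
    HasDerivAt (trigPoly n a b) (trigPoly n (fun k => k * b k) (fun k => -(k * a k)) x) x := by
  unfold trigPoly
  refine HasDerivAt.fun_sum fun k _ => ?_
  have h : HasDerivAt (fun y : ℝ => (k : ℝ) * y) k x := by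
    simpa using (hasDerivAt_id x).const_mul (k : ℝ)
  refine ((h.cos.const_mul (a k)).add (h.sin.const_mul (b k))).congr_deriv ?_
  ring

theorem deriv_trigPoly (n : ℕ) (a b : ℕ → ℝ) :
    deriv (trigPoly n a b) = trigPoly n (fun k => k * b k) (fun k => -(k * a k)) :=
  funext fun x => (hasDerivAt_trigPoly n a b x).deriv

theorem analyticAt_trigPoly (n : ℕ) (a b : ℕ → ℝ) (x : ℝ) : AnalyticAt ℝ (trigPoly n a b) x := by
  unfold trigPoly
  fun_prop

theorem continuous_trigPoly (n : ℕ) (a b : ℕ → ℝ) : Continuous (trigPoly n a b) := by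
  unfold trigPoly
  fun_prop

theorem periodic_trigPoly (n : ℕ) (a b : ℕ → ℝ) : Function.Periodic (trigPoly n a b) (2 * π) := by
  intro x
  refine Finset.sum_congr rfl fun k _ => ?_
  rw [mul_add, Real.cos_add_nat_mul_two_pi, Real.sin_add_nat_mul_two_pi]

theorem trigPoly_add (n : ℕ) (a b : ℕ → ℝ) (x y : ℝ) :
    trigPoly n a b (x + y)
      = trigPoly n (fun k => a k * Real.cos (k * x) + b k * Real.sin (k * x))
          (fun k => b k * Real.cos (k * x) - a k * Real.sin (k * x)) y := by
  refine Finset.sum_congr rfl fun k _ => ?_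
  rw [mul_add, Real.cos_add, Real.sin_add]
  ring

theorem trigPoly_zero (n : ℕ) (a b : ℕ → ℝ) :
    trigPoly n a b 0 = ∑ k ∈ Finset.range (n + 1), a k := by
  simp [trigPoly]

theorem iteratedDeriv_trigPoly_even (n : ℕ) (a b : ℕ → ℝ) (j : ℕ) :
    iteratedDeriv (2 * j) (trigPoly n a b)
      = trigPoly n (fun k => (-1) ^ j * (k : ℝ) ^ (2 * j) * a k)
          (fun k => (-1) ^ j * (k : ℝ) ^ (2 * j) * b k) := by
  induction j with
  | zero => simp
  | succ j ih =>
    rw [mul_add, mul_one, iteratedDeriv_succ, iteratedDeriv_succ, ih, deriv_trigPoly,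
      deriv_trigPoly]
    congr 1 <;> funext k <;> ring

theorem iteratedDeriv_trigPoly_odd (n : ℕ) (a b : ℕ → ℝ) (j : ℕ) :
    iteratedDeriv (2 * j + 1) (trigPoly n a b)
      = trigPoly n (fun k => (-1) ^ j * (k : ℝ) ^ (2 * j + 1) * b k)
          (fun k => -((-1) ^ j * (k : ℝ) ^ (2 * j + 1) * a k)) := by
  rw [iteratedDeriv_succ, iteratedDeriv_trigPoly_even, deriv_trigPoly]
  congr 1 <;> funext k <;> ring

theorem iteratedDeriv_trigPoly_even_zero (n : ℕ) (a b : ℕ → ℝ) (i : ℕ) :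
    iteratedDeriv (2 * i + 2) (trigPoly n a b) 0
      = (-1) ^ (i + 1) * ∑ k : Fin n, (((k : ℕ) : ℝ) + 1) ^ (2 * i + 2) * a (k + 1) := by
  rw [← mul_add_one 2 i, iteratedDeriv_trigPoly_even, trigPoly_zero, Finset.sum_range_succ',
    Finset.mul_sum, Fin.sum_univ_eq_sum_range
      (fun k => (-1 : ℝ) ^ (i + 1) * (((k : ℝ) + 1) ^ (2 * (i + 1)) * a (k + 1)))]
  simp [mul_assoc]

theorem iteratedDeriv_trigPoly_odd_zero (n : ℕ) (a b : ℕ → ℝ) (i : ℕ) :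
    iteratedDeriv (2 * i + 1) (trigPoly n a b) 0
      = (-1) ^ i * ∑ k : Fin n, (((k : ℕ) : ℝ) + 1) ^ (2 * i + 1) * b (k + 1) := by
  rw [iteratedDeriv_trigPoly_odd, trigPoly_zero, Finset.sum_range_succ', Finset.mul_sum,
    Fin.sum_univ_eq_sum_range
      (fun k => (-1 : ℝ) ^ i * (((k : ℝ) + 1) ^ (2 * i + 1) * b (k + 1)))]
  simp [mul_assoc]

theorem derivSystem_mulVec_eq_zero_iff (m n : ℕ) (v w : Fin n → ℝ) :
    (derivSystem m n).mulVec (Sum.elim v w) = 0 ↔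
      (∀ i : Fin m, ∑ k : Fin n, (((k : ℕ) : ℝ) + 1) ^ (2 * (i : ℕ) + 1) * v k = 0) ∧
      ∀ i : Fin m, ∑ k : Fin n, (((k : ℕ) : ℝ) + 1) ^ (2 * (i : ℕ) + 2) * w k = 0 := by
  rw [funext_iff, Sum.forall]
  simp [derivSystem, Matrix.mulVec, dotProduct, Fintype.sum_sum_type]

theorem iteratedDeriv_trigPoly_zero_eq_zero_iff (m n : ℕ) (a b : ℕ → ℝ) :
    (∀ l ∈ Finset.Icc 1 (2 * m), iteratedDeriv l (trigPoly n a b) 0 = 0) ↔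
      (derivSystem m n).mulVec
        (Sum.elim (fun k : Fin n => b (k + 1)) (fun k : Fin n => a (k + 1))) = 0 := by
  rw [derivSystem_mulVec_eq_zero_iff]
  constructor
  · intro h
    refine ⟨fun i => ?_, fun i => ?_⟩
    · have hodd := h (2 * i + 1) (Finset.mem_Icc.2 (by omega))
      rw [iteratedDeriv_trigPoly_odd_zero] at hodd
      simpa using hodd
    · have heven := h (2 * i + 2) (Finset.mem_Icc.2 (by omega))
      rw [iteratedDeriv_trigPoly_even_zero] at heven
      simpa using heven
  · rintro ⟨hb, ha⟩ l hl
    rw [Finset.mem_Icc] at hl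
    obtain ⟨i, rfl | rfl⟩ : ∃ i, l = 2 * i + 1 ∨ l = 2 * i + 2 := ⟨(l - 1) / 2, by omega⟩
    · rw [iteratedDeriv_trigPoly_odd_zero, hb ⟨i, by omega⟩, mul_zero]
    · rw [iteratedDeriv_trigPoly_even_zero, ha ⟨i, by omega⟩, mul_zero]

theorem det_of_pow_mul_add {R : Type*} [CommRing R] {m : ℕ} (x : Fin m → R) (p s : ℕ) :
    (Matrix.of fun i k : Fin m => x k ^ (p * (i : ℕ) + s)).det
      = (∏ k, x k) ^ s * (Matrix.vandermonde fun k => x k ^ p).det := by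
  have hfactor : (Matrix.of fun i k : Fin m => x k ^ (p * (i : ℕ) + s))
      = Matrix.of fun i k => x k ^ s * (Matrix.vandermonde fun k => x k ^ p).transpose i k := by
    ext i k
    simp only [Matrix.of_apply, Matrix.transpose_apply, Matrix.vandermonde_apply, ← pow_mul]
    ring
  rw [hfactor, Matrix.det_mul_row, Matrix.det_transpose, Finset.prod_pow]

theorem prod_fin_add_one (n : ℕ) : ∏ k : Fin n, (((k : ℕ) : ℝ) + 1) = n.factorial := by
  rw [Fin.prod_univ_eq_prod_range (fun k => (k : ℝ) + 1), ← Finset.prod_range_add_one_eq_factorial]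
  push_cast
  rfl

theorem det_derivSystem (n : ℕ) :
    (derivSystem n n).det = (n.factorial : ℝ) ^ 3 * vandermondeSq n ^ 2 := by
  rw [derivSystem, Matrix.det_fromBlocks_zero₂₁, det_of_pow_mul_add, det_of_pow_mul_add,
    prod_fin_add_one, vandermondeSq]
  ring

theorem det_derivSystem_ne_zero (n : ℕ) : (derivSystem n n).det ≠ 0 := by
  rw [det_derivSystem]
  refine mul_ne_zero (pow_ne_zero _ (by exact_mod_cast n.factorial_ne_zero)) (pow_ne_zero _ ?_)
  rw [vandermondeSq, Matrix.det_vandermonde_ne_zero_iff]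
  intro i j hij
  have h : ((i : ℕ) : ℝ) + 1 = (j : ℕ) + 1 :=
    (pow_left_inj₀ (by positivity) (by positivity) two_ne_zero).1 hij
  exact Fin.ext (by exact_mod_cast add_right_cancel h)

theorem trigPoly_eq_const_of_iteratedDeriv_zero_eq_zero
    (h : ∀ l ∈ Finset.Icc 1 (2 * n), iteratedDeriv l (trigPoly n a b) 0 = 0) (y : ℝ) :
    trigPoly n a b y = a 0 := by
  have hcoeff := Matrix.eq_zero_of_mulVec_eq_zero (det_derivSystem_ne_zero n)
    ((iteratedDeriv_trigPoly_zero_eq_zero_iff n n a b).1 h)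
  rw [trigPoly, Finset.sum_range_succ', Finset.sum_eq_zero]
  · simp
  · intro k hk
    have hb : b (k + 1) = 0 := congrFun hcoeff (Sum.inl ⟨k, Finset.mem_range.1 hk⟩)
    have ha : a (k + 1) = 0 := congrFun hcoeff (Sum.inr ⟨k, Finset.mem_range.1 hk⟩)
    rw [ha, hb, zero_mul, zero_mul, add_zero]

theorem lt_of_iteratedDeriv_trigPoly_eq_zero (hf : NonConst (trigPoly n a b)) {x : ℝ} {m : ℕ}
    (h : ∀ l ∈ Finset.Icc 1 m, iteratedDeriv l (trigPoly n a b) x = 0) : m < 2 * n := by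
  by_contra! hm
  refine hf ⟨a 0 * Real.cos ((0 : ℕ) * x) + b 0 * Real.sin ((0 : ℕ) * x), fun y => ?_⟩
  rw [← add_sub_cancel x y, trigPoly_add]
  refine trigPoly_eq_const_of_iteratedDeriv_zero_eq_zero (fun l hl => ?_) _
  rw [← funext (trigPoly_add n a b x), iteratedDeriv_comp_const_add]
  simpa using h l (Finset.Icc_subset_Icc_right hm hl)

theorem analyticOrderAt_deriv_trigPoly_lt (hf : NonConst (trigPoly n a b)) (x : ℝ) :
    analyticOrderAt (deriv (trigPoly n a b)) x < (2 * n : ℕ) := by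
  by_contra! hle
  rw [natCast_le_analyticOrderAt_iff_iteratedDeriv_eq_zero (analyticAt_trigPoly n a b x).deriv]
    at hle
  refine (lt_of_iteratedDeriv_trigPoly_eq_zero (x := x) hf fun l hl => ?_).false
  obtain ⟨hl₁, hl₂⟩ := Finset.mem_Icc.1 hl
  rw [← Nat.sub_add_cancel hl₁, iteratedDeriv_succ']
  exact hle _ (by omega)

end TrigPoly

section Variation

theorem exists_mutuallySingular_totalVariation_eq {E : Type*} [MeasurableSpace E]
    (P Q : Measure E) [IsFiniteMeasure P] [IsFiniteMeasure Q] :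
    ∃ p q : Measure E, IsFiniteMeasure p ∧ IsFiniteMeasure q ∧ p ⟂ₘ q ∧ P + q = Q + p ∧
      (P.toSignedMeasure - Q.toSignedMeasure).totalVariation = p + q := by
  let J := (P.toSignedMeasure - Q.toSignedMeasure).toJordanDecomposition
  refine ⟨J.posPart, J.negPart, inferInstance, inferInstance, J.mutuallySingular, ?_, rfl⟩
  have hJ : J.posPart.toSignedMeasure - J.negPart.toSignedMeasure
      = P.toSignedMeasure - Q.toSignedMeasure :=
    SignedMeasure.toSignedMeasure_toJordanDecomposition _
  rw [← Measure.toSignedMeasure_eq_toSignedMeasure_iff, Measure.toSignedMeasure_add,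
    Measure.toSignedMeasure_add, add_comm Q.toSignedMeasure]
  exact (sub_eq_sub_iff_add_eq_add.1 hJ).symm

theorem exists_boundedContinuous_integral_abs_sub_le {E : Type*} [MeasurableSpace E]
    [TopologicalSpace E] [NormalSpace E] [BorelSpace E] (ρ : Measure E) [IsFiniteMeasure ρ]
    [ρ.WeaklyRegular] {h : E → ℝ} (hm : Measurable h) (hb : ∀ x, |h x| ≤ 1) {ε : ℝ} (hε : 0 < ε) :
    ∃ g : E →ᵇ ℝ, ‖g‖ ≤ 1 ∧ ∫ x, |h x - g x| ∂ρ ≤ ε := by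
  have hi : Integrable h ρ := .of_bound hm.aestronglyMeasurable 1 (.of_forall hb)
  obtain ⟨g₀, hg₀, hg₀i⟩ := hi.exists_boundedContinuous_integral_sub_le hε
  let g : E →ᵇ ℝ := .ofNormedAddCommGroup (fun x => max (-1) (min 1 (g₀ x)))
    (by fun_prop) 1 fun x => abs_le.2 ⟨le_max_left _ _, max_le (by norm_num) (min_le_left _ _)⟩
  refine ⟨g, norm_ofNormedAddCommGroup_le _ zero_le_one _, ?_⟩
  refine le_trans (integral_mono (hi.sub (g.integrable ρ)).norm (hi.sub hg₀i).norm fun x => ?_) hg₀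
  have hx := abs_le.1 (hb x)
  calc |h x - g x| = |max (-1) (min 1 (h x)) - max (-1) (min 1 (g₀ x))| := by
        rw [min_eq_right hx.2, max_eq_right hx.1]; rfl
    _ ≤ |min 1 (h x) - min 1 (g₀ x)| := by
        rw [max_comm (-1), max_comm (-1)]; exact abs_max_sub_max_le_abs _ _ _
    _ ≤ |h x - g₀ x| := by
        simpa using abs_min_sub_min_le_max 1 (h x) 1 (g₀ x)

variable (P Q : Measure ℝ) [IsFiniteMeasure P] [IsFiniteMeasure Q]

theorem varDist_nonneg : 0 ≤ varDist P Q := measureReal_nonneg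

theorem abs_integral_sub_integral_le_norm_mul_varDist (h : ℝ →ᵇ ℝ) :
    |∫ x, h x ∂P - ∫ x, h x ∂Q| ≤ ‖h‖ * varDist P Q := by
  obtain ⟨p, q, _, _, -, hadd, htv⟩ := exists_mutuallySingular_totalVariation_eq P Q
  have hsum : ∫ x, h x ∂P + ∫ x, h x ∂q = ∫ x, h x ∂Q + ∫ x, h x ∂p := by
    rw [← integral_add_measure (h.integrable _) (h.integrable _), hadd,
      integral_add_measure (h.integrable _) (h.integrable _)]
  have hle (ρ : Measure ℝ) [IsFiniteMeasure ρ] : |∫ x, h x ∂ρ| ≤ ‖h‖ * ρ.real univ :=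
    norm_integral_le_of_norm_le_const (.of_forall h.norm_coe_le_norm)
  calc |∫ x, h x ∂P - ∫ x, h x ∂Q| = |∫ x, h x ∂p - ∫ x, h x ∂q| := by
        rw [sub_eq_sub_iff_add_eq_add.2 (hsum.trans (add_comm _ _))]
    _ ≤ |∫ x, h x ∂p| + |∫ x, h x ∂q| := abs_sub _ _
    _ ≤ ‖h‖ * p.real univ + ‖h‖ * q.real univ := add_le_add (hle p) (hle q)
    _ = ‖h‖ * varDist P Q := by rw [varDist, htv, measureReal_add_apply, mul_add]

theorem exists_measurable_integral_sub_integral_eq_varDist :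
    ∃ h : ℝ → ℝ, Measurable h ∧ (∀ x, |h x| ≤ 1) ∧
      ∫ x, h x ∂P - ∫ x, h x ∂Q = varDist P Q := by
  classical
  obtain ⟨p, q, _, _, ⟨s, hs, hps, hqs⟩, hadd, htv⟩ :=
    exists_mutuallySingular_totalVariation_eq P Q
  let h : ℝ → ℝ := fun x => if x ∈ s then -1 else 1
  have hm : Measurable h := measurable_const.ite hs measurable_const
  have hb (x : ℝ) : |h x| ≤ 1 := by by_cases hx : x ∈ s <;> simp [h, hx]
  have hi (ρ : Measure ℝ) [IsFiniteMeasure ρ] : Integrable h ρ :=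
    .of_bound hm.aestronglyMeasurable 1 (.of_forall hb)
  have hp : ∫ x, h x ∂p = p.real univ := by
    have hae : h =ᵐ[p] fun _ => 1 :=
      (measure_eq_zero_iff_ae_notMem.1 hps).mono fun x hx => if_neg hx
    rw [integral_congr_ae hae, integral_const, smul_eq_mul, mul_one]
  have hq : ∫ x, h x ∂q = -q.real univ := by
    have hae : h =ᵐ[q] fun _ => -1 :=
      (measure_eq_zero_iff_ae_notMem.1 hqs).mono fun x hx => if_pos (not_not.1 hx)
    rw [integral_congr_ae hae, integral_const, smul_eq_mul, mul_neg_one]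
  have hsum : ∫ x, h x ∂P + ∫ x, h x ∂q = ∫ x, h x ∂Q + ∫ x, h x ∂p := by
    rw [← integral_add_measure (hi _) (hi _), hadd, integral_add_measure (hi _) (hi _)]
  refine ⟨h, hm, hb, ?_⟩
  rw [varDist, htv, measureReal_add_apply]
  linarith

variable {P Q} in
theorem varDist_le_of_forall_boundedContinuous {C : ℝ}
    (hC : ∀ h : ℝ →ᵇ ℝ, ‖h‖ ≤ 1 → ∫ x, h x ∂P - ∫ x, h x ∂Q ≤ C) : varDist P Q ≤ C := by
  refine le_of_forall_pos_le_add fun ε hε => ?_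
  obtain ⟨h, hm, hb, hv⟩ := exists_measurable_integral_sub_integral_eq_varDist P Q
  obtain ⟨g, hg, hclose⟩ := exists_boundedContinuous_integral_abs_sub_le (P + Q) hm hb hε
  have hi (ρ : Measure ℝ) [IsFiniteMeasure ρ] : Integrable (fun x => h x - g x) ρ :=
    (Integrable.of_bound hm.aestronglyMeasurable 1 (.of_forall hb)).sub (g.integrable ρ)
  have hsplit (ρ : Measure ℝ) [IsFiniteMeasure ρ] :
      ∫ x, h x ∂ρ = ∫ x, g x ∂ρ + ∫ x, h x - g x ∂ρ := by
    rw [← integral_add (g.integrable ρ) (hi ρ)]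
    simp only [add_sub_cancel]
  rw [integral_add_measure (hi P).abs (hi Q).abs] at hclose
  have hP := (le_abs_self _).trans (abs_integral_le_integral_abs (f := fun x => h x - g x) (μ := P))
  have hQ := neg_le_of_abs_le (abs_integral_le_integral_abs (f := fun x => h x - g x) (μ := Q))
  rw [← hv, hsplit P, hsplit Q]
  linarith [hC g hg]

theorem varDist_map_le_iff_forall_boundedContinuous {Ω : Type*} [MeasurableSpace Ω]
    {μ : Measure Ω} [IsFiniteMeasure μ] {Y Z : Ω → ℝ} (hY : AEMeasurable Y μ)
    (hZ : AEMeasurable Z μ) {C : ℝ} :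
    varDist (μ.map Y) (μ.map Z) ≤ C ↔
      ∀ h : ℝ →ᵇ ℝ, |∫ ω, h (Y ω) ∂μ - ∫ ω, h (Z ω) ∂μ| ≤ ‖h‖ * C := by
  have hmap (h : ℝ →ᵇ ℝ) {Y : Ω → ℝ} (hY : AEMeasurable Y μ) :
      ∫ ω, h (Y ω) ∂μ = ∫ y, h y ∂μ.map Y :=
    (integral_map hY h.continuous.aestronglyMeasurable).symm
  refine ⟨fun hC h => ?_, fun hC => varDist_le_of_forall_boundedContinuous fun h hh => ?_⟩
  · rw [hmap h hY, hmap h hZ]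
    refine (abs_integral_sub_integral_le_norm_mul_varDist _ _ h).trans ?_
    gcongr
  · have hC0 : 0 ≤ C := by simpa using hC (.const ℝ 1)
    rw [← hmap h hY, ← hmap h hZ]
    exact (le_abs_self _).trans ((hC h).trans (mul_le_of_le_one_left hC0 hh))

end Variation

section SingularIntegrals

/-- The integrals of the functions `G δ`, `δ > 0`, with respect to `ρ` are at most `C * e δ`, with
a finite constant `C` that does not depend on `δ`. It expresses how fast integrals that become
singular in the limit `δ → 0` may blow up, and it can be checked locally on compact sets. -/
def LIntegralBoundedBy {E : Type*} [MeasurableSpace E] (ρ : Measure E) (G : ℝ → E → ℝ≥0∞)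
    (e : ℝ → ℝ≥0∞) : Prop :=
  ∃ C : ℝ≥0, ∀ δ, 0 < δ → ∫⁻ x, G δ x ∂ρ ≤ C * e δ

namespace LIntegralBoundedBy

variable {E : Type*} [MeasurableSpace E] {ρ : Measure E} {G : ℝ → E → ℝ≥0∞} {e : ℝ → ℝ≥0∞}
  {s t : Set E}

theorem mono_set (h : LIntegralBoundedBy (ρ.restrict t) G e) (hst : s ⊆ t) :
    LIntegralBoundedBy (ρ.restrict s) G e :=
  let ⟨C, hC⟩ := h
  ⟨C, fun δ hδ => (lintegral_mono_set hst).trans (hC δ hδ)⟩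

theorem union (hs : LIntegralBoundedBy (ρ.restrict s) G e)
    (ht : LIntegralBoundedBy (ρ.restrict t) G e) :
    LIntegralBoundedBy (ρ.restrict (s ∪ t)) G e := by
  obtain ⟨C, hC⟩ := hs
  obtain ⟨D, hD⟩ := ht
  refine ⟨C + D, fun δ hδ => (lintegral_union_le _ _ _).trans ?_⟩
  rw [ENNReal.coe_add, add_mul]
  exact add_le_add (hC δ hδ) (hD δ hδ)

theorem of_isCompact [TopologicalSpace E] (hs : IsCompact s)
    (h : ∀ x₀ ∈ s, ∃ t ∈ 𝓝 x₀, LIntegralBoundedBy (ρ.restrict t) G e) :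
    LIntegralBoundedBy (ρ.restrict s) G e := by
  refine hs.induction_on ⟨0, by simp⟩ (fun _ _ hst ht => ht.mono_set hst)
    (fun _ _ => union) fun x hx => ?_
  obtain ⟨t, ht, hbound⟩ := h x hx
  exact ⟨t, mem_nhdsWithin_of_mem_nhds ht, hbound⟩

end LIntegralBoundedBy

theorem lintegral_inv_one_add_div_sq {η : ℝ} (hη : 0 < η) {K : ℝ} (hK : 0 ≤ K) (x₀ : ℝ) :
    ∫⁻ x, .ofReal (K * (1 + ((x - x₀) / η) ^ 2)⁻¹) = .ofReal (K * π * η) := by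
  have hi : Integrable fun x : ℝ => K * (1 + ((x - x₀) / η) ^ 2)⁻¹ :=
    ((integrable_inv_one_add_sq.comp_div hη.ne').comp_sub_right x₀).const_mul K
  rw [← ofReal_integral_eq_lintegral_ofReal hi (.of_forall fun x => by positivity),
    integral_const_mul, integral_sub_right_eq_self (fun x : ℝ => (1 + (x / η) ^ 2)⁻¹) x₀,
    Measure.integral_comp_div (fun x : ℝ => (1 + x ^ 2)⁻¹), integral_univ_inv_one_add_sq,
    abs_of_pos hη, smul_eq_mul, mul_comm η, mul_assoc]

theorem lintegral_inv_sq_add_sq {δ : ℝ} (hδ : 0 < δ) :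
    ∫⁻ y, .ofReal (y ^ 2 + δ ^ 2)⁻¹ = .ofReal (π * (1 / δ)) := by
  have hscale (y : ℝ) : (y ^ 2 + δ ^ 2)⁻¹ = (δ ^ 2)⁻¹ * (1 + ((y - 0) / δ) ^ 2)⁻¹ := by
    rw [← mul_inv, mul_add, mul_one, sub_zero, div_pow, mul_div_cancel₀ _ (by positivity), add_comm]
  simp only [hscale]
  rw [lintegral_inv_one_add_div_sq hδ (by positivity)]
  congr 1
  field_simp

variable {F F' : ℝ → ℝ}

theorem injOn_of_hasDerivAt_ne_zero {s : Set ℝ} (hs : s.OrdConnected)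
    (hF : ∀ x ∈ s, HasDerivAt F (F' x) x) (h0 : ∀ x ∈ interior s, F' x ≠ 0) : InjOn F s := by
  suffices hlt : ∀ x ∈ s, ∀ y ∈ s, x < y → F x ≠ F y by
    intro x hx y hy hxy
    rcases lt_trichotomy x y with h | h | h
    · exact absurd hxy (hlt x hx y hy h)
    · exact h
    · exact absurd hxy.symm (hlt y hy x hx h)
  intro x hx y hy hxy hFxy
  have hsub : Icc x y ⊆ s := hs.out hx hy
  obtain ⟨z, hz, hz0⟩ := exists_hasDerivAt_eq_zero hxy
    (fun z hz => (hF z (hsub hz)).continuousAt.continuousWithinAt) hFxy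
    fun z hz => hF z (hsub (Ioo_subset_Icc_self hz))
  exact h0 z (interior_maximal (Ioo_subset_Icc_self.trans hsub) isOpen_Ioo hz) hz0

theorem lintegral_abs_deriv_div_sq_add_sq_le_of_injOn {s : Set ℝ} (hs : MeasurableSet s)
    (hF : ∀ x ∈ s, HasDerivWithinAt F (F' x) s x) (hinj : InjOn F s) {δ : ℝ} (hδ : 0 < δ) :
    ∫⁻ x in s, .ofReal (|F' x| / (F x ^ 2 + δ ^ 2)) ≤ .ofReal (π * (1 / δ)) := by
  calc ∫⁻ x in s, .ofReal (|F' x| / (F x ^ 2 + δ ^ 2))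
      = ∫⁻ x in s, .ofReal |F' x| * .ofReal (F x ^ 2 + δ ^ 2)⁻¹ := by
        simp only [div_eq_mul_inv, ENNReal.ofReal_mul (abs_nonneg _)]
    _ = ∫⁻ y in F '' s, .ofReal (y ^ 2 + δ ^ 2)⁻¹ :=
        (lintegral_image_eq_lintegral_abs_deriv_mul hs hF hinj fun y =>
          .ofReal (y ^ 2 + δ ^ 2)⁻¹).symm
    _ ≤ ∫⁻ y, .ofReal (y ^ 2 + δ ^ 2)⁻¹ := setLIntegral_le_lintegral _ _
    _ = .ofReal (π * (1 / δ)) := lintegral_inv_sq_add_sq hδ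

theorem exists_nhds_lintegralBoundedBy_abs_deriv_div {x₀ : ℝ} (hF : AnalyticAt ℝ F x₀) :
    ∃ t ∈ 𝓝 x₀, LIntegralBoundedBy (volume.restrict t)
      (fun δ x => .ofReal (|deriv F x| / (F x ^ 2 + δ ^ 2))) fun δ => .ofReal (1 / δ) := by
  rcases hF.deriv.eventually_eq_zero_or_eventually_ne_zero with hzero | hne
  · obtain ⟨r, hr, h⟩ := Metric.eventually_nhds_iff_ball.1 hzero
    refine ⟨_, Metric.ball_mem_nhds x₀ hr, 0, fun δ _ => ?_⟩
    rw [setLIntegral_congr_fun (g := 0) Metric.isOpen_ball.measurableSet fun x hx => by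
      simp [h x hx]]
    simp
  obtain ⟨r, hr, h⟩ := Metric.eventually_nhds_iff_ball.1
    (hF.eventually_analyticAt.and (eventually_nhdsWithin_iff.1 hne))
  rw [Real.ball_eq_Ioo] at h
  have hbound {s : Set ℝ} (hs : s.OrdConnected) (hsr : s ⊆ Ioo (x₀ - r) (x₀ + r))
      (hx₀ : x₀ ∉ interior s) : LIntegralBoundedBy (volume.restrict s)
        (fun δ x => .ofReal (|deriv F x| / (F x ^ 2 + δ ^ 2))) fun δ => .ofReal (1 / δ) := by
    have hderiv : ∀ x ∈ s, HasDerivAt F (deriv F x) x := fun x hx =>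
      (h x (hsr hx)).1.differentiableAt.hasDerivAt
    have hinj : InjOn F s := injOn_of_hasDerivAt_ne_zero hs hderiv fun x hx =>
      (h x (hsr (interior_subset hx))).2 (ne_of_mem_of_not_mem hx hx₀)
    refine ⟨Real.toNNReal π, fun δ hδ => ?_⟩
    refine (lintegral_abs_deriv_div_sq_add_sq_le_of_injOn hs.measurableSet
      (fun x hx => (hderiv x hx).hasDerivWithinAt) hinj hδ).trans_eq ?_
    rw [ENNReal.ofReal_mul Real.pi_nonneg, ENNReal.ofReal]
  refine ⟨Ioo (x₀ - r) (x₀ + r), Ioo_mem_nhds (by linarith) (by linarith), ?_⟩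
  rw [← Ioc_union_Ico_eq_Ioo (sub_lt_self x₀ hr) (lt_add_of_pos_right x₀ hr)]
  exact (hbound ordConnected_Ioc (Ioc_subset_Ioo_right (by linarith)) (by simp)).union
    (hbound ordConnected_Ico (Ico_subset_Ioo_left (by linarith)) (by simp))

theorem exists_mul_pow_norm_sub_le_norm_of_analyticOrderAt_le {𝕜 E : Type*}
    [NontriviallyNormedField 𝕜] [NormedAddCommGroup E] [NormedSpace 𝕜 E] {F : 𝕜 → E} {x₀ : 𝕜}
    (hF : AnalyticAt 𝕜 F x₀) {N : ℕ} (hN : analyticOrderAt F x₀ ≤ N) :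
    ∃ c : ℝ, 0 < c ∧ ∀ᶠ x in 𝓝 x₀, c * ‖x - x₀‖ ^ N ≤ ‖F x‖ := by
  obtain ⟨m, hm⟩ := ENat.ne_top_iff_exists.1 (ne_top_of_le_ne_top (ENat.natCast_ne_top N) hN)
  have hmN : m ≤ N := by exact_mod_cast hm.trans_le hN
  obtain ⟨g, hg, hg0, hFg⟩ := hF.analyticOrderAt_eq_natCast.1 hm.symm
  have hgpos : 0 < ‖g x₀‖ := norm_pos_iff.2 hg0
  have hg_near : ∀ᶠ x in 𝓝 x₀, ‖g x₀‖ / 2 < ‖g x‖ :=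
    hg.continuousAt.norm.eventually (lt_mem_nhds (half_lt_self hgpos))
  refine ⟨‖g x₀‖ / 2, half_pos hgpos, ?_⟩
  filter_upwards [hFg, hg_near, Metric.ball_mem_nhds x₀ one_pos] with x hx hgx hball
  have hpow : ‖x - x₀‖ ^ N ≤ ‖x - x₀‖ ^ m :=
    pow_le_pow_of_le_one (norm_nonneg _) (mem_ball_iff_norm.1 hball).le hmN
  rw [hx, norm_smul, norm_pow, mul_comm]
  gcongr

theorem inv_one_add_sq_mul_sq_pow_le {c : ℝ} (hc : 0 < c) (z : ℝ) {N : ℕ} (hN : N ≠ 0) :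
    (1 + c ^ 2 * (z ^ N) ^ 2)⁻¹ ≤ (2 + 1 / c ^ 2) * (1 + z ^ 2)⁻¹ := by
  have hz : z ^ 2 ≤ 1 + (z ^ N) ^ 2 := by
    rw [← pow_mul, mul_comm, pow_mul]
    rcases le_total (z ^ 2) 1 with h | h
    · linarith [show 0 ≤ (z ^ 2) ^ N by positivity]
    · linarith [le_self_pow₀ h hN]
  rw [← div_eq_mul_inv, le_div_iff₀ (by positivity), inv_mul_le_iff₀ (by positivity)]
  calc 1 + z ^ 2 ≤ 2 + (z ^ N) ^ 2 := by linarith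
    _ ≤ 2 + (z ^ N) ^ 2 + (1 / c ^ 2 + 2 * (c ^ 2 * (z ^ N) ^ 2)) :=
        le_add_of_nonneg_right (by positivity)
    _ = (1 + c ^ 2 * (z ^ N) ^ 2) * (2 + 1 / c ^ 2) := by
        field_simp
        ring

theorem exists_nhds_lintegralBoundedBy_sq_div {x₀ : ℝ} (hF : AnalyticAt ℝ F x₀) {N : ℕ}
    (hN : N ≠ 0) (hord : analyticOrderAt F x₀ ≤ N) :
    ∃ t ∈ 𝓝 x₀, LIntegralBoundedBy (volume.restrict t)
      (fun r x => .ofReal ((r ^ N) ^ 2 / (F x ^ 2 + (r ^ N) ^ 2))) .ofReal := by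
  obtain ⟨c, hc, hlow⟩ := exists_mul_pow_norm_sub_le_norm_of_analyticOrderAt_le hF hord
  obtain ⟨η, hη, h⟩ := Metric.eventually_nhds_iff_ball.1 hlow
  refine ⟨_, Metric.ball_mem_nhds x₀ hη, ((2 + 1 / c ^ 2) * π).toNNReal, fun r hr => ?_⟩
  have hpoint : ∀ x ∈ Metric.ball x₀ η, (r ^ N) ^ 2 / (F x ^ 2 + (r ^ N) ^ 2)
      ≤ (2 + 1 / c ^ 2) * (1 + ((x - x₀) / r) ^ 2)⁻¹ := by
    intro x hx
    have hsq : c ^ 2 * ((x - x₀) ^ N) ^ 2 ≤ F x ^ 2 := by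
      have := pow_le_pow_left₀ (by positivity) (h x hx) 2
      rwa [mul_pow, Real.norm_eq_abs, Real.norm_eq_abs, ← abs_pow, sq_abs, sq_abs] at this
    refine le_trans ?_ (inv_one_add_sq_mul_sq_pow_le hc _ hN)
    rw [← inv_div, add_div, div_self (by positivity), add_comm, div_pow _ r, div_pow _ (r ^ N),
      ← mul_div_assoc]
    gcongr
  calc ∫⁻ x in Metric.ball x₀ η, .ofReal ((r ^ N) ^ 2 / (F x ^ 2 + (r ^ N) ^ 2))
      ≤ ∫⁻ x in Metric.ball x₀ η, .ofReal ((2 + 1 / c ^ 2) * (1 + ((x - x₀) / r) ^ 2)⁻¹) :=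
        setLIntegral_mono' Metric.isOpen_ball.measurableSet fun x hx =>
          ENNReal.ofReal_le_ofReal (hpoint x hx)
    _ ≤ ∫⁻ x, .ofReal ((2 + 1 / c ^ 2) * (1 + ((x - x₀) / r) ^ 2)⁻¹) :=
        setLIntegral_le_lintegral _ _
    _ = _ := by
        rw [lintegral_inv_one_add_div_sq hr (by positivity), ENNReal.ofReal_mul (by positivity),
          ENNReal.ofReal]

end SingularIntegrals

section Periodic

theorem setLIntegral_Ioc_add_eq_of_periodic {T : ℝ} (hT : 0 < T) {G : ℝ → ℝ≥0∞}
    (hG : Function.Periodic G T) (s t : ℝ) :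
    ∫⁻ x in Ioc s (s + T), G x = ∫⁻ x in Ioc t (t + T), G x := by
  refine (isAddFundamentalDomain_Ioc hT s).setLIntegral_eq (isAddFundamentalDomain_Ioc hT t) G ?_
  rintro ⟨g, hg⟩ x
  obtain ⟨k, rfl⟩ := AddSubgroup.mem_zmultiples_iff.1 hg
  rw [AddSubgroup.mk_vadd, vadd_eq_add, add_comm]
  exact hG.zsmul k x

theorem lintegral_mul_le_tsum_mul_of_periodic {T : ℝ} (hT : 0 < T) {φ G : ℝ → ℝ≥0∞}
    (hG : Function.Periodic G T) {c : ℤ → ℝ≥0}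
    (hφ : ∀ k : ℤ, ∀ x ∈ Ioc (k • T) ((k + 1) • T), φ x ≤ c k) :
    ∫⁻ x, φ x * G x ≤ (∑' k, (c k : ℝ≥0∞)) * ∫⁻ x in Ioc 0 T, G x := by
  rw [← setLIntegral_univ, ← iUnion_Ioc_zsmul hT, ← ENNReal.tsum_mul_right]
  refine (lintegral_iUnion_le _ _).trans (ENNReal.tsum_le_tsum fun k => ?_)
  calc ∫⁻ x in Ioc (k • T) ((k + 1) • T), φ x * G x
      ≤ ∫⁻ x in Ioc (k • T) ((k + 1) • T), c k * G x :=
        setLIntegral_mono' measurableSet_Ioc fun x hx => mul_le_mul_left (hφ k x hx) _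
    _ = c k * ∫⁻ x in Ioc (k • T) (k • T + T), G x := by
        rw [lintegral_const_mul' _ _ ENNReal.coe_ne_top, add_smul, one_smul]
    _ = c k * ∫⁻ x in Ioc 0 T, G x := by
        rw [setLIntegral_Ioc_add_eq_of_periodic hT hG _ 0, zero_add]

theorem summable_int_inv_one_add_sq : Summable fun k : ℤ => (1 + (k : ℝ) ^ 2)⁻¹ := by
  refine .of_nonneg_of_le (fun k => by positivity) (fun k => ?_)
    (((Real.summable_one_div_int_pow (p := 2)).2 one_lt_two).add
      (hasSum_pi_single (0 : ℤ) (1 : ℝ)).summable)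
  rcases eq_or_ne k 0 with rfl | hk
  · simp
  · rw [Pi.single_eq_of_ne hk, add_zero, one_div]
    exact inv_anti₀ (by positivity) (by linarith)

theorem gaussianPDFReal_le_inv_one_add_sq (x : ℝ) :
    gaussianPDFReal 0 1 x ≤ (1 + x ^ 2 / 2)⁻¹ := by
  have hconst : (√(2 * π))⁻¹ ≤ 1 :=
    inv_le_one_of_one_le₀ (Real.one_le_sqrt.2 (by linarith [Real.pi_gt_three]))
  have hexp : Real.exp (-(x ^ 2 / 2)) ≤ (1 + x ^ 2 / 2)⁻¹ := by
    rw [Real.exp_neg]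
    exact inv_anti₀ (by positivity) (by linarith [Real.add_one_le_exp (x ^ 2 / 2)])
  calc gaussianPDFReal 0 1 x = (√(2 * π))⁻¹ * Real.exp (-(x ^ 2 / 2)) := by
        simp [gaussianPDFReal_def, neg_div]
    _ ≤ 1 * (1 + x ^ 2 / 2)⁻¹ := by gcongr
    _ = (1 + x ^ 2 / 2)⁻¹ := one_mul _

theorem gaussianPDFReal_le_of_mem_Ioc_zsmul {T : ℝ} (hT : 0 < T) {k : ℤ} {x : ℝ}
    (hx : x ∈ Ioc (k • T) ((k + 1) • T)) :
    gaussianPDFReal 0 1 x ≤ (3 + 4 / T ^ 2) * (1 + (k : ℝ) ^ 2)⁻¹ := by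
  simp only [zsmul_eq_mul, Int.cast_add, Int.cast_one] at hx
  have hlow : (k : ℝ) < x / T := (lt_div_iff₀ hT).2 hx.1
  have hupp : x / T ≤ k + 1 := (div_le_iff₀ hT).2 hx.2
  have hfrac : (x / T - k) ^ 2 ≤ 1 := pow_le_one₀ (by linarith) (by linarith)
  have hk : (k : ℝ) ^ 2 ≤ 2 * (x / T) ^ 2 + 2 := by linarith [sq_nonneg (2 * (x / T) - k)]
  refine (gaussianPDFReal_le_inv_one_add_sq x).trans ?_
  rw [← div_eq_mul_inv, inv_le_comm₀ (by positivity) (by positivity), inv_div,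
    div_le_iff₀ (by positivity)]
  calc 1 + (k : ℝ) ^ 2 ≤ 3 + 2 * (x / T) ^ 2 := by linarith
    _ ≤ 3 + 2 * (x / T) ^ 2 + (3 * (x ^ 2 / 2) + 4 / T ^ 2) :=
        le_add_of_nonneg_right (by positivity)
    _ = (1 + x ^ 2 / 2) * (3 + 4 / T ^ 2) := by ring

theorem LIntegralBoundedBy.gaussianReal_of_periodic {T : ℝ} (hT : 0 < T) {G : ℝ → ℝ → ℝ≥0∞}
    {e : ℝ → ℝ≥0∞} (hG : ∀ δ, Function.Periodic (G δ) T)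
    (h : LIntegralBoundedBy (volume.restrict (Ioc 0 T)) G e) :
    LIntegralBoundedBy (gaussianReal 0 1) G e := by
  obtain ⟨C, hC⟩ := h
  let c : ℤ → ℝ≥0 := fun k => ((3 + 4 / T ^ 2) * (1 + (k : ℝ) ^ 2)⁻¹).toNNReal
  have hc : Summable c := (summable_int_inv_one_add_sq.mul_left _).toNNReal
  refine ⟨(∑' k, c k) * C, fun δ hδ => ?_⟩
  calc ∫⁻ x, G δ x ∂gaussianReal 0 1 ≤ ∫⁻ x, gaussianPDF 0 1 x * G δ x := by
        rw [gaussianReal_of_var_ne_zero 0 one_ne_zero]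
        exact lintegral_withDensity_le_lintegral_mul _ (measurable_gaussianPDF 0 1) _
    _ ≤ (∑' k, (c k : ℝ≥0∞)) * ∫⁻ x in Ioc 0 T, G δ x :=
        lintegral_mul_le_tsum_mul_of_periodic hT (hG δ) fun k x hx =>
          ENNReal.ofReal_le_ofReal (gaussianPDFReal_le_of_mem_Ioc_zsmul hT hx)
    _ ≤ (∑' k, c k : ℝ≥0) * (C * e δ) := by
        rw [ENNReal.coe_tsum hc]
        gcongr
        exact hC δ hδ
    _ = ((∑' k, c k) * C : ℝ≥0) * e δ := by rw [ENNReal.coe_mul, mul_assoc]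

end Periodic

section IntegrationByParts

theorem hasDerivAt_gaussianPDFReal (m : ℝ) {v : ℝ≥0} (hv : v ≠ 0) (x : ℝ) :
    HasDerivAt (gaussianPDFReal m v) (-((x - m) / v) * gaussianPDFReal m v x) x := by
  have hquad : HasDerivAt (fun x => -(x - m) ^ 2 / (2 * v)) (-((x - m) / v)) x := by
    refine ((((hasDerivAt_id x).sub_const m).fun_pow 2).fun_neg.div_const _).congr_deriv ?_
    simp only [id]
    field_simp
    push_cast
    ring
  rw [gaussianPDFReal_def]
  refine (hquad.exp.const_mul (√(2 * π * v))⁻¹).congr_deriv ?_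
  ring

theorem integrable_gaussianReal_iff_integrable_mul (m : ℝ) {v : ℝ≥0} (hv : v ≠ 0) (G : ℝ → ℝ) :
    Integrable G (gaussianReal m v) ↔ Integrable fun x => gaussianPDFReal m v x * G x := by
  rw [gaussianReal_of_var_ne_zero m hv, integrable_withDensity_iff_integrable_smul'
    (measurable_gaussianPDF m v) (.of_forall fun _ => gaussianPDF_lt_top)]
  simp only [toReal_gaussianPDF, smul_eq_mul]

theorem integral_sub_mul_gaussianReal (m : ℝ) (v : ℝ≥0) {G G' : ℝ → ℝ}
    (hG : ∀ x, HasDerivAt G (G' x) x) (hi : Integrable G (gaussianReal m v))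
    (hi' : Integrable G' (gaussianReal m v))
    (hxi : Integrable (fun x => (x - m) * G x) (gaussianReal m v)) :
    ∫ x, (x - m) * G x ∂gaussianReal m v = v * ∫ x, G' x ∂gaussianReal m v := by
  rcases eq_or_ne v 0 with rfl | hv
  · simp [gaussianReal_zero_var]
  rw [integrable_gaussianReal_iff_integrable_mul m hv] at hi hi' hxi
  have hderiv (x : ℝ) : HasDerivAt (fun x => gaussianPDFReal m v x * G x)
      (gaussianPDFReal m v x * G' x - (v : ℝ)⁻¹ * (gaussianPDFReal m v x * ((x - m) * G x))) x :=
    ((hasDerivAt_gaussianPDFReal m hv x).fun_mul (hG x)).congr_deriv (by ring)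
  have hzero := integral_eq_zero_of_hasDerivAt_of_integrable hderiv
    (hi'.sub (hxi.const_mul _)) hi
  rw [integral_sub hi' (hxi.const_mul _), integral_const_mul, sub_eq_zero] at hzero
  simp only [integral_gaussianReal_eq_integral_smul hv, smul_eq_mul, hzero]
  rw [mul_inv_cancel_left₀ (by exact_mod_cast hv)]

theorem integrable_abs_gaussianReal (m : ℝ) (v : ℝ≥0) :
    Integrable (fun x : ℝ => |x|) (gaussianReal m v) :=
  IsGaussian.integrable_id.abs

theorem integral_abs_gaussianReal_le_one : ∫ x, |x| ∂gaussianReal 0 1 ≤ 1 := by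
  have hsq : ∫ x, x ^ 2 ∂gaussianReal 0 1 = 1 := by
    have := variance_fun_id_gaussianReal (μ := 0) (v := 1)
    rw [variance_eq_integral (by fun_prop), integral_id_gaussianReal] at this
    simpa using this
  have hi : Integrable (fun x : ℝ => x ^ 2) (gaussianReal 0 1) :=
    (memLp_id_gaussianReal 2).integrable_sq
  calc ∫ x, |x| ∂gaussianReal 0 1 ≤ ∫ x, (1 + x ^ 2) / 2 ∂gaussianReal 0 1 :=
        integral_mono (integrable_abs_gaussianReal 0 1) (((integrable_const 1).add hi).div_const 2)
          fun x => by
            have := two_mul_le_add_sq 1 |x|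
            rw [sq_abs] at this
            simp only
            linarith
    _ = 1 := by
        rw [integral_div, integral_add (integrable_const 1) hi, hsq]
        simp

theorem hasDerivAt_integral_increment {h : ℝ → ℝ} (hc : Continuous h) (u y : ℝ) :
    HasDerivAt (fun y => ∫ s in y..y + u, h s) (h (y + u) - h y) y := by
  have hprim (z : ℝ) : HasDerivAt (fun z => ∫ s in 0..z, h s) (h z) z :=
    intervalIntegral.integral_hasDerivAt_right (hc.intervalIntegrable _ _)
      (hc.stronglyMeasurableAtFilter _ _) hc.continuousAt
  refine (((hprim (y + u)).comp_add_const y u).sub (hprim y)).congr_of_eventuallyEq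
    (.of_forall fun z => ?_)
  exact (intervalIntegral.integral_interval_sub_left (hc.intervalIntegrable _ _)
    (hc.intervalIntegrable _ _)).symm

variable (h : ℝ →ᵇ ℝ) (u : ℝ)

theorem abs_integral_increment_le (y : ℝ) : |∫ s in y..y + u, h s| ≤ ‖h‖ * |u| := by
  simpa using intervalIntegral.norm_integral_le_of_norm_le_const (a := y) (b := y + u) (f := h)
    fun x _ => h.norm_coe_le_norm x

theorem norm_apply_add_sub_apply_le (y : ℝ) : ‖h (y + u) - h y‖ ≤ 2 * ‖h‖ := by
  rw [← dist_eq_norm]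
  exact h.dist_le_two_norm _ _

/-- The boundary-free integration by parts behind the shift estimates: with `H` the increment of a
primitive of `h`, the function `(h (f + u) - h f) * f'` is the derivative of `H ∘ f`. -/
theorem abs_integral_increment_mul_deriv_le {f f' W W' : ℝ → ℝ}
    (hf : ∀ x, HasDerivAt f (f' x) x) (hW : ∀ x, HasDerivAt W (W' x) x)
    (hWi : Integrable W (gaussianReal 0 1)) (hWi' : Integrable W' (gaussianReal 0 1))
    (hxW : Integrable (fun x => x * W x) (gaussianReal 0 1))
    (hfW : Integrable (fun x => f' x * W x) (gaussianReal 0 1)) :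
    |∫ x, (h (f x + u) - h (f x)) * (f' x * W x) ∂gaussianReal 0 1|
      ≤ ‖h‖ * |u| * ∫ x, |x * W x - W' x| ∂gaussianReal 0 1 := by
  have hfc : Continuous f := continuous_iff_continuousAt.2 fun x => (hf x).continuousAt
  have hH := hasDerivAt_integral_increment h.continuous u
  set H : ℝ → ℝ := fun y => ∫ s in y..y + u, h s
  have hHc : Continuous H := continuous_iff_continuousAt.2 fun y => (hH y).continuousAt
  have hHb (x : ℝ) : ‖H (f x)‖ ≤ ‖h‖ * |u| := abs_integral_increment_le h u (f x)
  have hHmul {g : ℝ → ℝ} (hg : Integrable g (gaussianReal 0 1)) :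
      Integrable (fun x => H (f x) * g x) (gaussianReal 0 1) :=
    hg.bdd_mul (hHc.comp hfc).aestronglyMeasurable (.of_forall hHb)
  have hinc : Integrable (fun x => (h (f x + u) - h (f x)) * (f' x * W x)) (gaussianReal 0 1) :=
    hfW.bdd_mul (by have := h.continuous; fun_prop)
      (.of_forall fun x => norm_apply_add_sub_apply_le h u (f x))
  have hstein := integral_sub_mul_gaussianReal 0 1 (G := fun x => H (f x) * W x)
    (G' := fun x => (h (f x + u) - h (f x)) * (f' x * W x) + H (f x) * W' x)
    (fun x => (((hH (f x)).comp x (hf x)).mul (hW x)).congr_deriv (by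
      simp only [Function.comp_apply]
      ring))
    (hHmul hWi) (hinc.add (hHmul hWi'))
    ((hHmul hxW).congr (.of_forall fun x => by ring))
  rw [integral_add hinc (hHmul hWi'), NNReal.coe_one, one_mul, ← sub_eq_iff_eq_add,
    ← integral_sub ((hHmul hxW).congr (.of_forall fun x => by ring)) (hHmul hWi')] at hstein
  rw [← hstein, ← integral_const_mul, ← Real.norm_eq_abs]
  refine norm_integral_le_of_norm_le ((hxW.sub hWi').abs.const_mul _) (.of_forall fun x => ?_)
  calc ‖(x - 0) * (H (f x) * W x) - H (f x) * W' x‖ = ‖H (f x)‖ * |x * W x - W' x| := by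
        rw [← Real.norm_eq_abs, ← norm_mul]
        ring_nf
    _ ≤ ‖h‖ * |u| * |x * W x - W' x| := by
        gcongr
        exact hHb x

theorem abs_integral_increment_gaussianReal_le :
    |∫ t, (h (t + u) - h t) ∂gaussianReal 0 1| ≤ ‖h‖ * |u| := by
  have key := abs_integral_increment_mul_deriv_le h u (W := fun _ => 1) (W' := fun _ => 0)
    hasDerivAt_id (fun x => hasDerivAt_const x 1) (integrable_const 1) (integrable_const 0)
    (by simpa only [mul_one] using IsGaussian.integrable_fun_id)
    (by simp)
  simp only [id, mul_one, sub_zero] at key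
  exact key.trans (mul_le_of_le_one_right (by positivity) integral_abs_gaussianReal_le_one)

end IntegrationByParts

section RegularizedQuotient

variable {F F' : ℝ → ℝ} {δ : ℝ}

theorem hasDerivAt_div_sq_add_sq (hδ : 0 < δ) {x F₁ : ℝ} (hF : HasDerivAt F F₁ x) :
    HasDerivAt (fun x => F x / (F x ^ 2 + δ ^ 2))
      ((δ ^ 2 - F x ^ 2) / (F x ^ 2 + δ ^ 2) ^ 2 * F₁) x := by
  refine (hF.fun_div ((hF.fun_pow 2).add_const (δ ^ 2)) (by positivity)).congr_deriv ?_
  rw [div_mul_eq_mul_div]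
  push_cast
  ring

theorem abs_div_sq_add_sq_le (hδ : 0 < δ) (y : ℝ) : |y / (y ^ 2 + δ ^ 2)| ≤ 1 / (2 * δ) := by
  rw [abs_div, abs_of_pos (show 0 < y ^ 2 + δ ^ 2 by positivity),
    div_le_div_iff₀ (by positivity) (by positivity), ← sq_abs y]
  linarith [two_mul_le_add_sq |y| δ]

theorem abs_sq_sub_sq_div_le (hδ : 0 < δ) (y : ℝ) :
    |(δ ^ 2 - y ^ 2) / (y ^ 2 + δ ^ 2) ^ 2| ≤ 1 / (y ^ 2 + δ ^ 2) := by
  have hpos : 0 < y ^ 2 + δ ^ 2 := by positivity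
  have hnum : |δ ^ 2 - y ^ 2| ≤ y ^ 2 + δ ^ 2 :=
    abs_le.2 ⟨by linarith [sq_nonneg δ], by linarith [sq_nonneg y]⟩
  rw [abs_div, abs_of_pos (pow_pos hpos 2), div_le_div_iff₀ (pow_pos hpos 2) hpos, one_mul,
    sq (y ^ 2 + δ ^ 2)]
  gcongr

theorem one_div_sq_add_sq_le (hδ : 0 < δ) (y : ℝ) : 1 / (y ^ 2 + δ ^ 2) ≤ 1 / δ ^ 2 :=
  one_div_le_one_div_of_le (by positivity) (le_add_of_nonneg_left (sq_nonneg y))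

theorem integrable_abs_div_sq_add_sq {ρ : Measure ℝ} (hF : Continuous F) (hF' : Integrable F' ρ)
    (hδ : 0 < δ) : Integrable (fun x => |F' x| / (F x ^ 2 + δ ^ 2)) ρ := by
  have hpos (x : ℝ) : F x ^ 2 + δ ^ 2 ≠ 0 := by positivity
  have hc : Continuous fun x => 1 / (F x ^ 2 + δ ^ 2) :=
    continuous_const.div (by fun_prop) hpos
  refine (hF'.abs.bdd_mul (c := 1 / δ ^ 2) hc.aestronglyMeasurable (.of_forall fun x => ?_)).congr
    (.of_forall fun x => one_div_mul_eq_div _ _)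
  rw [Real.norm_of_nonneg (by positivity)]
  exact one_div_sq_add_sq_le hδ _

theorem integrable_sq_div_sq_add_sq {ρ : Measure ℝ} [IsFiniteMeasure ρ] (hF : Continuous F)
    (hδ : 0 < δ) : Integrable (fun x => δ ^ 2 / (F x ^ 2 + δ ^ 2)) ρ := by
  refine .of_bound (continuous_const.div (by fun_prop) fun x => by positivity).aestronglyMeasurable
    1 (.of_forall fun x => ?_)
  rw [Real.norm_of_nonneg (by positivity)]
  exact div_le_one_of_le₀ (le_add_of_nonneg_left (sq_nonneg _)) (by positivity)

theorem integrable_mul_div_sq_add_sq {ρ : Measure ℝ} {g : ℝ → ℝ} (hg : Integrable g ρ)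
    (hF : Continuous F) (hδ : 0 < δ) :
    Integrable (fun x => g x * (F x / (F x ^ 2 + δ ^ 2))) ρ := by
  have hc : Continuous fun x => F x / (F x ^ 2 + δ ^ 2) :=
    hF.div (by fun_prop) fun x => by positivity
  exact hg.mul_bdd hc.aestronglyMeasurable (.of_forall fun x => abs_div_sq_add_sq_le hδ (F x))

theorem integrable_sq_sub_sq_div_mul {ρ : Measure ℝ} (hF' : Integrable F' ρ) (hF : Continuous F)
    (hδ : 0 < δ) :
    Integrable (fun x => (δ ^ 2 - F x ^ 2) / (F x ^ 2 + δ ^ 2) ^ 2 * F' x) ρ := by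
  have hc : Continuous fun x => (δ ^ 2 - F x ^ 2) / (F x ^ 2 + δ ^ 2) ^ 2 :=
    .div (by fun_prop) (by fun_prop) fun x => by positivity
  exact hF'.bdd_mul hc.aestronglyMeasurable
    (.of_forall fun x => (abs_sq_sub_sq_div_le hδ _).trans (one_div_sq_add_sq_le hδ _))

theorem integral_abs_mul_quotient_sub_deriv_le (hF : Continuous F)
    (hF' : Integrable F' (gaussianReal 0 1)) (hδ : 0 < δ) :
    ∫ x, |x * (F x / (F x ^ 2 + δ ^ 2))
        - (δ ^ 2 - F x ^ 2) / (F x ^ 2 + δ ^ 2) ^ 2 * F' x| ∂gaussianReal 0 1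
      ≤ (∫ x, |F' x| / (F x ^ 2 + δ ^ 2) ∂gaussianReal 0 1) + 1 / (2 * δ) := by
  have hquot := integrable_abs_div_sq_add_sq hF hF' hδ
  have habs := (integrable_abs_gaussianReal 0 1).mul_const (1 / (2 * δ))
  have hdiff := (integrable_mul_div_sq_add_sq IsGaussian.integrable_id hF hδ).sub
    (integrable_sq_sub_sq_div_mul hF' hF hδ)
  calc ∫ x, |x * (F x / (F x ^ 2 + δ ^ 2))
        - (δ ^ 2 - F x ^ 2) / (F x ^ 2 + δ ^ 2) ^ 2 * F' x| ∂gaussianReal 0 1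
      ≤ ∫ x, (|F' x| / (F x ^ 2 + δ ^ 2) + |x| * (1 / (2 * δ))) ∂gaussianReal 0 1 := by
        refine integral_mono hdiff.abs (hquot.add habs) fun x => (abs_sub _ _).trans ?_
        rw [abs_mul, abs_mul, add_comm, ← one_div_mul_eq_div _ |F' x|]
        gcongr
        · exact abs_sq_sub_sq_div_le hδ _
        · exact abs_div_sq_add_sq_le hδ _
    _ ≤ (∫ x, |F' x| / (F x ^ 2 + δ ^ 2) ∂gaussianReal 0 1) + 1 / (2 * δ) := by
        rw [integral_add hquot habs, integral_mul_const]
        gcongr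
        exact mul_le_of_le_one_left (by positivity) integral_abs_gaussianReal_le_one

variable (h : ℝ →ᵇ ℝ) (u : ℝ) {f : ℝ → ℝ}

theorem abs_integral_increment_mul_quotient_le (hf : ∀ x, HasDerivAt f (F x) x)
    (hF : ∀ x, HasDerivAt F (F' x) x) (hF'i : Integrable F' (gaussianReal 0 1)) (hδ : 0 < δ) :
    |∫ x, (h (f x + u) - h (f x)) * (F x * (F x / (F x ^ 2 + δ ^ 2))) ∂gaussianReal 0 1|
      ≤ ‖h‖ * |u| * ((∫ x, |F' x| / (F x ^ 2 + δ ^ 2) ∂gaussianReal 0 1) + 1 / (2 * δ)) := by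
  have hFc : Continuous F := continuous_iff_continuousAt.2 fun x => (hF x).continuousAt
  have hW : Integrable (fun x => F x / (F x ^ 2 + δ ^ 2)) (gaussianReal 0 1) := by
    simpa using integrable_mul_div_sq_add_sq (integrable_const (1 : ℝ)) hFc hδ
  have hFW : Integrable (fun x => F x * (F x / (F x ^ 2 + δ ^ 2))) (gaussianReal 0 1) := by
    refine ((integrable_const 1).sub (integrable_sq_div_sq_add_sq hFc hδ)).congr
      (.of_forall fun x => ?_)
    have : F x ^ 2 + δ ^ 2 ≠ 0 := by positivity
    simp only [Pi.sub_apply]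
    field_simp
    ring
  refine (abs_integral_increment_mul_deriv_le h u hf
    (fun x => hasDerivAt_div_sq_add_sq hδ (hF x)) hW (integrable_sq_sub_sq_div_mul hF'i hFc hδ)
    (integrable_mul_div_sq_add_sq IsGaussian.integrable_id hFc hδ) hFW).trans ?_
  gcongr
  exact integral_abs_mul_quotient_sub_deriv_le hFc hF'i hδ

theorem abs_integral_increment_comp_le (hf : ∀ x, HasDerivAt f (F x) x)
    (hF : ∀ x, HasDerivAt F (F' x) x) (hF'i : Integrable F' (gaussianReal 0 1)) (hδ : 0 < δ) :
    |∫ x, (h (f x + u) - h (f x)) ∂gaussianReal 0 1|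
      ≤ ‖h‖ * (|u| * ((∫ x, |F' x| / (F x ^ 2 + δ ^ 2) ∂gaussianReal 0 1) + 1 / (2 * δ))
        + 2 * ∫ x, δ ^ 2 / (F x ^ 2 + δ ^ 2) ∂gaussianReal 0 1) := by
  have hfc : Continuous f := continuous_iff_continuousAt.2 fun x => (hf x).continuousAt
  have hFc : Continuous F := continuous_iff_continuousAt.2 fun x => (hF x).continuousAt
  have hinc (x : ℝ) := norm_apply_add_sub_apply_le h u (f x)
  have hrest := integrable_sq_div_sq_add_sq (ρ := gaussianReal 0 1) hFc hδ
  have hi₀ : Integrable (fun x => h (f x + u) - h (f x)) (gaussianReal 0 1) :=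
    .of_bound (by have := h.continuous; fun_prop) _ (.of_forall hinc)
  have hi₁ := hrest.bdd_mul hi₀.aestronglyMeasurable (.of_forall hinc)
  have hsplit : ∫ x, (h (f x + u) - h (f x)) ∂gaussianReal 0 1
      = (∫ x, (h (f x + u) - h (f x)) * (F x * (F x / (F x ^ 2 + δ ^ 2))) ∂gaussianReal 0 1)
        + ∫ x, (h (f x + u) - h (f x)) * (δ ^ 2 / (F x ^ 2 + δ ^ 2)) ∂gaussianReal 0 1 := by
    rw [← sub_eq_iff_eq_add, ← integral_sub hi₀ hi₁]
    congr 1 with x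
    have : F x ^ 2 + δ ^ 2 ≠ 0 := by positivity
    field_simp
    ring
  have hsmall : |∫ x, (h (f x + u) - h (f x)) * (δ ^ 2 / (F x ^ 2 + δ ^ 2)) ∂gaussianReal 0 1|
      ≤ 2 * ‖h‖ * ∫ x, δ ^ 2 / (F x ^ 2 + δ ^ 2) ∂gaussianReal 0 1 := by
    rw [← integral_const_mul, ← Real.norm_eq_abs]
    refine norm_integral_le_of_norm_le (hrest.const_mul _) (.of_forall fun x => ?_)
    rw [norm_mul, Real.norm_of_nonneg (by positivity : 0 ≤ δ ^ 2 / (F x ^ 2 + δ ^ 2))]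
    gcongr
    exact hinc x
  rw [hsplit]
  refine (abs_add_le _ _).trans ((add_le_add
    (abs_integral_increment_mul_quotient_le h u hf hF hF'i hδ) hsmall).trans_eq ?_)
  ring

end RegularizedQuotient

section ShiftBound

theorem LIntegralBoundedBy.exists_integral_le {E : Type*} [MeasurableSpace E] {ρ : Measure E}
    {G : ℝ → E → ℝ} {e : ℝ → ℝ} (hG : ∀ δ x, 0 ≤ G δ x) (he : ∀ δ, 0 < δ → 0 ≤ e δ)
    (h : LIntegralBoundedBy ρ (fun δ x => .ofReal (G δ x)) fun δ => .ofReal (e δ)) :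
    ∃ C : ℝ, ∀ δ, 0 < δ → ∫ x, G δ x ∂ρ ≤ C * e δ := by
  obtain ⟨C, hC⟩ := h
  refine ⟨C, fun δ hδ => ?_⟩
  have hnonneg : 0 ≤ C * e δ := mul_nonneg C.coe_nonneg (he δ hδ)
  by_cases hi : Integrable (G δ) ρ
  · rw [← ENNReal.ofReal_le_ofReal_iff hnonneg,
      ofReal_integral_eq_lintegral_ofReal hi (.of_forall (hG δ)),
      ENNReal.ofReal_mul C.coe_nonneg, ENNReal.ofReal_coe_nnreal]
    exact hC δ hδ
  · rwa [integral_undef hi]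

theorem integrable_of_continuous_of_periodic {ρ : Measure ℝ} [IsFiniteMeasure ρ] {T : ℝ}
    (hT : T ≠ 0) {F : ℝ → ℝ} (hF : Continuous F) (hp : Function.Periodic F T) :
    Integrable F ρ := by
  obtain ⟨B, hB⟩ := (hp.isBounded_of_continuous hT hF).exists_norm_le
  exact .of_bound hF.aestronglyMeasurable B (.of_forall fun x => hB _ (mem_range_self x))

theorem periodic_deriv {f : ℝ → ℝ} {T : ℝ} (hp : Function.Periodic f T) :
    Function.Periodic (deriv f) T := fun x => by
  rw [← deriv_comp_add_const, hp.funext]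

variable {f : ℝ → ℝ} {T : ℝ} {N : ℕ}

theorem exists_integral_singular_le (hf : ∀ x, AnalyticAt ℝ f x) (hT : 0 < T)
    (hp : Function.Periodic f T) (hN : N ≠ 0)
    (hord : ∀ x, analyticOrderAt (deriv f) x ≤ N) :
    ∃ A B : ℝ, ∀ r, 0 < r →
      ∫ x, |deriv (deriv f) x| / (deriv f x ^ 2 + (r ^ N) ^ 2) ∂gaussianReal 0 1 ≤ A / r ^ N ∧
      ∫ x, (r ^ N) ^ 2 / (deriv f x ^ 2 + (r ^ N) ^ 2) ∂gaussianReal 0 1 ≤ B * r := by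
  have hp' := periodic_deriv hp
  have hp'' := periodic_deriv hp'
  obtain ⟨A, hA⟩ := LIntegralBoundedBy.exists_integral_le (fun δ x => by positivity)
    (fun δ hδ => by positivity) (.gaussianReal_of_periodic hT
      (fun δ x => by simp only [hp' x, hp'' x])
      ((LIntegralBoundedBy.of_isCompact isCompact_Icc fun x₀ _ =>
        exists_nhds_lintegralBoundedBy_abs_deriv_div (hf x₀).deriv).mono_set Ioc_subset_Icc_self))
  obtain ⟨B, hB⟩ := LIntegralBoundedBy.exists_integral_le (fun r x => by positivity)
    (fun r hr => hr.le) (.gaussianReal_of_periodic hT (fun r x => by simp only [hp' x])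
      ((LIntegralBoundedBy.of_isCompact isCompact_Icc fun x₀ _ =>
        exists_nhds_lintegralBoundedBy_sq_div (hf x₀).deriv hN (hord x₀)).mono_set
          Ioc_subset_Icc_self))
  exact ⟨A, B, fun r hr => ⟨(hA _ (by positivity)).trans_eq (mul_one_div _ _), hB r hr⟩⟩

theorem exists_abs_integral_increment_le_rpow (hf : ∀ x, AnalyticAt ℝ f x) (hT : 0 < T)
    (hp : Function.Periodic f T) (hN : N ≠ 0)
    (hord : ∀ x, analyticOrderAt (deriv f) x ≤ N) :
    ∃ C : ℝ, ∀ (h : ℝ →ᵇ ℝ) (u : ℝ), |∫ x, (h (f x + u) - h (f x)) ∂gaussianReal 0 1|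
      ≤ ‖h‖ * (C * |u| ^ (1 / ((N : ℝ) + 1))) := by
  have hderiv {g : ℝ → ℝ} (hg : ∀ x, AnalyticAt ℝ g x) (x : ℝ) : HasDerivAt g (deriv g x) x :=
    (hg x).differentiableAt.hasDerivAt
  have hf'' : Integrable (deriv (deriv f)) (gaussianReal 0 1) :=
    integrable_of_continuous_of_periodic hT.ne'
      (continuous_iff_continuousAt.2 fun x => (hf x).deriv.deriv.continuousAt)
      (periodic_deriv (periodic_deriv hp))
  obtain ⟨A, B, hAB⟩ := exists_integral_singular_le hf hT hp hN hord
  refine ⟨A + 1 / 2 + 2 * B, fun h u => ?_⟩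
  rcases eq_or_ne u 0 with rfl | hu
  · simp [Real.zero_rpow (show ((N : ℝ) + 1)⁻¹ ≠ 0 by positivity)]
  -- The choice `δ = r ^ N` with `r ^ (N + 1) = |u|` balances `|u| / δ` against `δ ^ (1 / N)`.
  set r : ℝ := |u| ^ (1 / ((N : ℝ) + 1))
  have hr : 0 < r := Real.rpow_pos_of_pos (abs_pos.2 hu) _
  have hru : r ^ N * r = |u| := by
    rw [← pow_succ, ← Real.rpow_mul_natCast (abs_nonneg u), Nat.cast_add_one,
      one_div_mul_cancel (by positivity), Real.rpow_one]
  obtain ⟨hA, hB⟩ := hAB r hr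
  refine (abs_integral_increment_comp_le h u (hderiv hf) (hderiv fun x => (hf x).deriv) hf''
    (pow_pos hr N)).trans ?_
  gcongr
  calc |u| * (_ + 1 / (2 * r ^ N)) + 2 * _
      ≤ |u| * (A / r ^ N + 1 / (2 * r ^ N)) + 2 * (B * r) := by gcongr
    _ = (A + 1 / 2 + 2 * B) * r := by
        rw [← hru]
        field_simp

variable {Ω : Type*} [MeasurableSpace Ω] {μ : Measure Ω} [IsFiniteMeasure μ] {X : Ω → ℝ}

theorem exists_shiftBound_of_analyticOrderAt_deriv_le (hX : HasLaw X (gaussianReal 0 1) μ)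
    (hf : ∀ x, AnalyticAt ℝ f x) (hT : 0 < T) (hp : Function.Periodic f T) (hN : N ≠ 0)
    (hord : ∀ x, analyticOrderAt (deriv f) x ≤ N) :
    ∃ C : ℝ, ShiftBound μ (fun ω => f (X ω)) (1 / ((N : ℝ) + 1)) C := by
  obtain ⟨C, hC⟩ := exists_abs_integral_increment_le_rpow hf hT hp hN hord
  have hfc : Continuous f := continuous_iff_continuousAt.2 fun x => (hf x).continuousAt
  have hY : AEMeasurable (fun ω => f (X ω)) μ := hfc.measurable.comp_aemeasurable hX.aemeasurable
  refine ⟨C, fun u => (varDist_map_le_iff_forall_boundedContinuous hY (hY.add_const u)).2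
    fun h => ?_⟩
  have hlaw (v : ℝ) : ∫ ω, h (f (X ω) + v) ∂μ = ∫ x, h (f x + v) ∂gaussianReal 0 1 :=
    hX.integral_comp (f := fun x => h (f x + v))
      (by have := h.continuous; fun_prop : Continuous fun x => h (f x + v)).aestronglyMeasurable
  have hi (v : ℝ) : Integrable (fun x => h (f x + v)) (gaussianReal 0 1) :=
    .of_bound (by have := h.continuous; fun_prop) _ (.of_forall fun x => h.norm_coe_le_norm _)
  have h₀ := hlaw 0
  have hi₀ := hi 0
  simp only [add_zero] at h₀ hi₀
  rw [h₀, hlaw u, abs_sub_comm, ← integral_sub (hi u) hi₀]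
  exact hC h u

theorem exists_shiftBound_trigPoly (hX : HasLaw X (gaussianReal 0 1) μ) {n : ℕ} (hn : 1 ≤ n)
    {a b : ℕ → ℝ} (hf : NonConst (trigPoly n a b)) :
    ∃ C : ℝ, ShiftBound μ (fun ω => trigPoly n a b (X ω)) (1 / (2 * (n : ℝ))) C := by
  have hcast : ((2 * n - 1 : ℕ) : ℝ) + 1 = 2 * n := by
    rw [← Nat.cast_add_one, Nat.sub_add_cancel (by omega)]
    push_cast
    rfl
  rw [← hcast]
  refine exists_shiftBound_of_analyticOrderAt_deriv_le hX (analyticAt_trigPoly n a b)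
    Real.two_pi_pos (periodic_trigPoly n a b) (by omega) fun x => ?_
  refine Order.le_of_lt_add_one ((analyticOrderAt_deriv_trigPoly_lt hf x).trans_eq ?_)
  rw [← Nat.cast_add_one, Nat.sub_add_cancel (by omega)]

end ShiftBound

section Smoothing

variable {Ω : Type*} [MeasurableSpace Ω] {μ : Measure Ω} {Y Z : Ω → ℝ} {α C D ε : ℝ}

theorem nonneg_of_shiftBound [IsFiniteMeasure μ] (hS : ShiftBound μ Y α C) : 0 ≤ C := by
  simpa using (varDist_nonneg _ _).trans (hS 1)

theorem integrable_abs_rpow_gaussianReal (m : ℝ) (v : ℝ≥0) (hα : 0 ≤ α) :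
    Integrable (fun t : ℝ => |t| ^ α) (gaussianReal m v) := by
  simpa [Real.coe_toNNReal α hα] using
    (memLp_id_gaussianReal (μ := m) (v := v) α.toNNReal).integrable_norm_rpow'

variable (h : ℝ →ᵇ ℝ)

theorem abs_integral_translate_gaussianReal_le (hε : 0 < ε) (p q : ℝ) :
    |∫ t, (h (p + ε * t) - h (q + ε * t)) ∂gaussianReal 0 1| ≤ ‖h‖ * (|p - q| / ε) := by
  let k : ℝ →ᵇ ℝ := h.compContinuous ⟨fun t => q + ε * t, by fun_prop⟩
  have hk (t : ℝ) : k (t + (p - q) / ε) = h (p + ε * t) := by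
    simp only [k, compContinuous_apply, ContinuousMap.coe_mk]
    congr 1
    field_simp
    ring
  calc |∫ t, (h (p + ε * t) - h (q + ε * t)) ∂gaussianReal 0 1|
      = |∫ t, (k (t + (p - q) / ε) - k t) ∂gaussianReal 0 1| := by simp only [hk]; rfl
    _ ≤ ‖k‖ * |(p - q) / ε| := abs_integral_increment_gaussianReal_le k _
    _ ≤ ‖h‖ * (|p - q| / ε) := by
        rw [abs_div, abs_of_pos hε]
        gcongr
        exact norm_compContinuous_le _ _

theorem integrable_uncurry_smoothing [IsFiniteMeasure μ] (hY : AEMeasurable Y μ) (ε : ℝ) :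
    Integrable (Function.uncurry fun t ω => h (Y ω + ε * t)) ((gaussianReal 0 1).prod μ) := by
  refine .of_bound ?_ ‖h‖ (.of_forall fun _ => h.norm_coe_le_norm _)
  exact (h.continuous.measurable.comp_aemeasurable
    (hY.comp_snd.add (by fun_prop))).aestronglyMeasurable

theorem abs_integral_sub_smoothing_le [IsFiniteMeasure μ] (hY : AEMeasurable Y μ)
    (hα : 0 ≤ α) (hS : ShiftBound μ Y α C) (hε : 0 < ε) :
    |∫ ω, h (Y ω) ∂μ - ∫ t, ∫ ω, h (Y ω + ε * t) ∂μ ∂gaussianReal 0 1|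
      ≤ ‖h‖ * (C * ε ^ α * ∫ t, |t| ^ α ∂gaussianReal 0 1) := by
  have hmean : ∫ ω, h (Y ω) ∂μ - ∫ t, ∫ ω, h (Y ω + ε * t) ∂μ ∂gaussianReal 0 1
      = ∫ t, (∫ ω, h (Y ω) ∂μ - ∫ ω, h (Y ω + ε * t) ∂μ) ∂gaussianReal 0 1 := by
    have hi : Integrable (fun t => ∫ ω, h (Y ω + ε * t) ∂μ) (gaussianReal 0 1) :=
      (integrable_uncurry_smoothing h hY ε).integral_prod_left
    rw [integral_sub (integrable_const _) hi, integral_const, probReal_univ, one_smul]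
  rw [hmean, ← integral_const_mul, ← integral_const_mul, ← Real.norm_eq_abs]
  refine norm_integral_le_of_norm_le
    (((integrable_abs_rpow_gaussianReal 0 1 hα).const_mul _).const_mul _) (.of_forall fun t => ?_)
  refine ((varDist_map_le_iff_forall_boundedContinuous hY (hY.add_const _)).1
    (hS (ε * t)) h).trans_eq ?_
  rw [abs_mul, abs_of_pos hε, Real.mul_rpow hε.le (abs_nonneg t), mul_assoc C]

variable [IsProbabilityMeasure μ]

theorem abs_smoothing_sub_smoothing_le (hY : AEMeasurable Y μ) (hZ : AEMeasurable Z μ)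
    (hD : ∀ᵐ ω ∂μ, |Y ω - Z ω| ≤ D) (hε : 0 < ε) :
    |∫ t, ∫ ω, h (Y ω + ε * t) ∂μ ∂gaussianReal 0 1
        - ∫ t, ∫ ω, h (Z ω + ε * t) ∂μ ∂gaussianReal 0 1| ≤ ‖h‖ * (D / ε) := by
  have hYi := integrable_uncurry_smoothing h hY ε
  have hZi := integrable_uncurry_smoothing h hZ ε
  have hslice (p : ℝ) : Integrable (fun t => h (p + ε * t)) (gaussianReal 0 1) :=
    .of_bound (by have := h.continuous; fun_prop) _ (.of_forall fun x => h.norm_coe_le_norm _)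
  have hYi' : Integrable (fun ω => ∫ t, h (Y ω + ε * t) ∂gaussianReal 0 1) μ :=
    hYi.integral_prod_right
  have hZi' : Integrable (fun ω => ∫ t, h (Z ω + ε * t) ∂gaussianReal 0 1) μ :=
    hZi.integral_prod_right
  rw [integral_integral_swap hYi, integral_integral_swap hZi, ← integral_sub hYi' hZi']
  rw [← Real.norm_eq_abs, ← mul_one (‖h‖ * (D / ε)), ← probReal_univ (μ := μ)]
  refine norm_integral_le_of_norm_le_const ?_
  filter_upwards [hD] with ω hω
  rw [← integral_sub (hslice _) (hslice _)]
  refine (abs_integral_translate_gaussianReal_le h hε _ _).trans ?_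
  gcongr

theorem varDist_map_le_rpow_add_div {Cf Cg : ℝ} (hY : AEMeasurable Y μ) (hZ : AEMeasurable Z μ)
    (hα : 0 ≤ α) (hYS : ShiftBound μ Y α Cf) (hZS : ShiftBound μ Z α Cg)
    (hD : ∀ᵐ ω ∂μ, |Y ω - Z ω| ≤ D) (hε : 0 < ε) :
    varDist (μ.map Y) (μ.map Z)
      ≤ (Cf + Cg) * ε ^ α * (∫ t, |t| ^ α ∂gaussianReal 0 1) + D / ε := by
  refine (varDist_map_le_iff_forall_boundedContinuous hY hZ).2 fun h => ?_
  have hYsmooth := abs_integral_sub_smoothing_le h hY hα hYS hε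
  have hcompare := abs_smoothing_sub_smoothing_le h hY hZ hD hε
  have hZsmooth := abs_integral_sub_smoothing_le h hZ hα hZS hε
  rw [abs_sub_comm] at hZsmooth
  refine (abs_sub_le _ _ _).trans ((add_le_add hYsmooth
    ((abs_sub_le _ _ _).trans (add_le_add hcompare hZsmooth))).trans_eq ?_)
  ring

end Smoothing

section Optimization

variable {v S M D α : ℝ}

theorem exists_pos_rpow_add_div_eq (hS : 0 < S) (hD : 0 < D) (hα : 0 < α) :
    ∃ ε, 0 < ε ∧ S * ε ^ α * M + D / ε = S ^ (1 / (α + 1)) * (M + 1) * D ^ (α / (α + 1)) := by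
  have hα' : 1 - 1 / (α + 1) = α / (α + 1) := by
    field_simp
    ring
  have hα'' : 1 - α / (α + 1) = 1 / (α + 1) := by rw [← hα', sub_sub_cancel]
  have hS' : S ^ (1 / (α + 1)) = S / S ^ (α / (α + 1)) := by
    rw [← Real.rpow_one_sub' hS.le (by rw [hα'']; positivity), hα'']
  have hD' : D ^ (α / (α + 1)) = D / D ^ (1 / (α + 1)) := by
    rw [← Real.rpow_one_sub' hD.le (by rw [hα']; positivity), hα']
  refine ⟨(D / S) ^ (1 / (α + 1)), by positivity, ?_⟩
  rw [← Real.rpow_mul (by positivity), one_div_mul_eq_div, Real.div_rpow hD.le hS.le,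
    Real.div_rpow hD.le hS.le, mul_add_one, add_mul]
  congr 1
  · rw [hS']
    ring
  · rw [hD', div_div_eq_mul_div]
    ring

theorem le_of_forall_pos_le_rpow_add_div (hS : 0 ≤ S) (hM : 0 ≤ M) (hD : 0 ≤ D) (hα : 0 < α)
    (h : ∀ ε, 0 < ε → v ≤ S * ε ^ α * M + D / ε) :
    v ≤ S ^ (1 / (α + 1)) * (M + 1) * D ^ (α / (α + 1)) := by
  -- If `S = 0` or `D = 0` the infimum over `ε` is not attained, hence the perturbation by `η`.
  have hpert : ∀ η, 0 < η →
      v ≤ (S + η) ^ (1 / (α + 1)) * (M + 1) * (D + η) ^ (α / (α + 1)) := by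
    intro η hη
    obtain ⟨ε, hε, heq⟩ := exists_pos_rpow_add_div_eq (M := M) (add_pos_of_nonneg_of_pos hS hη)
      (add_pos_of_nonneg_of_pos hD hη) hα
    rw [← heq]
    refine (h ε hε).trans ?_
    gcongr <;> linarith
  have hcont : Continuous fun η : ℝ =>
      (S + η) ^ (1 / (α + 1)) * (M + 1) * (D + η) ^ (α / (α + 1)) :=
    (((by fun_prop : Continuous fun η : ℝ => S + η).rpow_const
      fun _ => .inr (by positivity)).mul_const _).mul
      ((by fun_prop : Continuous fun η : ℝ => D + η).rpow_const fun _ => .inr (by positivity))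
  have hlim := (hcont.tendsto 0).mono_left (nhdsWithin_le_nhds (s := Ioi 0))
  simp only [add_zero] at hlim
  exact ge_of_tendsto hlim (eventually_mem_nhdsWithin.mono hpert)

end Optimization

section VariationDistance

variable {Ω : Type*} [MeasurableSpace Ω] {μ : Measure Ω} [IsProbabilityMeasure μ]

theorem varDist_map_le_boundConst_mul_rpow {Y Z : Ω → ℝ} {α Cf Cg D : ℝ} (hY : AEMeasurable Y μ)
    (hZ : AEMeasurable Z μ) (hα : 0 < α) (hYS : ShiftBound μ Y α Cf) (hZS : ShiftBound μ Z α Cg)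
    (hD : ∀ᵐ ω ∂μ, |Y ω - Z ω| ≤ D) :
    varDist (μ.map Y) (μ.map Z) ≤ boundConst α Cf Cg * D ^ (α / (α + 1)) := by
  obtain ⟨ω, hω⟩ := hD.exists
  have hD0 : 0 ≤ D := (abs_nonneg _).trans hω
  have hS0 : 0 ≤ Cf + Cg := add_nonneg (nonneg_of_shiftBound hYS) (nonneg_of_shiftBound hZS)
  have hsqrt : 1 ≤ √(π / 2) := Real.one_le_sqrt.2 (by linarith [Real.pi_gt_three])
  refine (le_of_forall_pos_le_rpow_add_div hS0 (integral_nonneg fun t => by positivity) hD0 hα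
    fun ε => varDist_map_le_rpow_add_div hY hZ hα.le hYS hZS hD).trans ?_
  rw [boundConst]
  gcongr

theorem abs_sub_le_supDist {f g : ℝ → ℝ} (hfg : BddAbove (range fun x => |f x - g x|)) (x : ℝ) :
    |f x - g x| ≤ supDist f g :=
  le_ciSup hfg x

theorem bddAbove_range_abs_trigPoly_sub_trigPoly (n : ℕ) (a b c d : ℕ → ℝ) :
    BddAbove (range fun x => |trigPoly n a b x - trigPoly n c d x|) := by
  refine (Function.Periodic.isBounded_of_continuous (c := 2 * π) (fun x => ?_)
    Real.two_pi_pos.ne' ?_).bddAbove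
  · simp only [periodic_trigPoly n a b x, periodic_trigPoly n c d x]
  · exact ((continuous_trigPoly n a b).sub (continuous_trigPoly n c d)).abs

theorem varDist_map_trigPoly_le {X : Ω → ℝ} (hX : AEMeasurable X μ) {n : ℕ} (hn : 1 ≤ n)
    {a b c d : ℕ → ℝ} {Cf Cg : ℝ}
    (hf : ShiftBound μ (fun ω => trigPoly n a b (X ω)) (1 / (2 * (n : ℝ))) Cf)
    (hg : ShiftBound μ (fun ω => trigPoly n c d (X ω)) (1 / (2 * (n : ℝ))) Cg) :
    varDist (μ.map fun ω => trigPoly n a b (X ω)) (μ.map fun ω => trigPoly n c d (X ω))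
      ≤ boundConst (1 / (2 * (n : ℝ))) Cf Cg *
        supDist (trigPoly n a b) (trigPoly n c d) ^ (1 / (2 * (n : ℝ) + 1)) := by
  have hn0 : (0 : ℝ) < n := by exact_mod_cast hn
  have hexp : 1 / (2 * (n : ℝ)) / (1 / (2 * (n : ℝ)) + 1) = 1 / (2 * (n : ℝ) + 1) := by
    field_simp
    ring
  have hmeas (a b : ℕ → ℝ) : AEMeasurable (fun ω => trigPoly n a b (X ω)) μ :=
    (continuous_trigPoly n a b).measurable.comp_aemeasurable hX
  rw [← hexp]
  exact varDist_map_le_boundConst_mul_rpow (hmeas a b) (hmeas c d)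
    (one_div_pos.2 (mul_pos two_pos hn0)) hf hg
    (.of_forall fun ω => abs_sub_le_supDist
      (bddAbove_range_abs_trigPoly_sub_trigPoly n a b c d) (X ω))

end VariationDistance

end TrigGauss

theorem mainTheorem6 {Ω : Type*} [MeasurableSpace Ω] (μ : MeasureTheory.Measure Ω)
    [MeasureTheory.IsProbabilityMeasure μ] (X : Ω → ℝ)
    (hX : ProbabilityTheory.HasLaw X (ProbabilityTheory.gaussianReal 0 1) μ)
    (n : ℕ) (hn : 1 ≤ n) :
    (∀ (m : ℕ) (a b : ℕ → ℝ),
      (∀ l ∈ Finset.Icc 1 (2 * m), iteratedDeriv l (TrigGauss.trigPoly n a b) 0 = 0) ↔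
        (TrigGauss.derivSystem m n).mulVec
          (Sum.elim (fun k : Fin n => b (k + 1)) (fun k : Fin n => a (k + 1))) = 0) ∧
    (TrigGauss.derivSystem n n).det
      = (n.factorial : ℝ) ^ 3 * TrigGauss.vandermondeSq n ^ 2 ∧
    (TrigGauss.derivSystem n n).det ≠ 0 ∧
    (∀ a b : ℕ → ℝ, TrigGauss.NonConst (TrigGauss.trigPoly n a b) →
      ∀ (x : ℝ) (m : ℕ),
        (∀ l ∈ Finset.Icc 1 m, iteratedDeriv l (TrigGauss.trigPoly n a b) x = 0) →
          m ≤ 2 * n - 1) ∧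
    (∀ a b : ℕ → ℝ, TrigGauss.NonConst (TrigGauss.trigPoly n a b) →
      ∃ C : ℝ, TrigGauss.ShiftBound μ (fun ω => TrigGauss.trigPoly n a b (X ω))
        (1 / (2 * (n : ℝ))) C) ∧
    (∀ a b c d : ℕ → ℝ, TrigGauss.NonConst (TrigGauss.trigPoly n a b) →
      TrigGauss.NonConst (TrigGauss.trigPoly n c d) →
      ∀ Cf Cg : ℝ,
        TrigGauss.ShiftBound μ (fun ω => TrigGauss.trigPoly n a b (X ω))
          (1 / (2 * (n : ℝ))) Cf →
        TrigGauss.ShiftBound μ (fun ω => TrigGauss.trigPoly n c d (X ω))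
          (1 / (2 * (n : ℝ))) Cg →
        TrigGauss.varDist (μ.map fun ω => TrigGauss.trigPoly n a b (X ω))
            (μ.map fun ω => TrigGauss.trigPoly n c d (X ω))
          ≤ TrigGauss.boundConst (1 / (2 * (n : ℝ))) Cf Cg *
            TrigGauss.supDist (TrigGauss.trigPoly n a b) (TrigGauss.trigPoly n c d)
              ^ (1 / (2 * (n : ℝ) + 1))) :=
  ⟨fun m => TrigGauss.iteratedDeriv_trigPoly_zero_eq_zero_iff m n, TrigGauss.det_derivSystem n,
    TrigGauss.det_derivSystem_ne_zero n,
    fun _ _ hf _ _ hzero =>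
      Nat.le_sub_one_of_lt (TrigGauss.lt_of_iteratedDeriv_trigPoly_eq_zero hf hzero),
    fun _ _ hf => TrigGauss.exists_shiftBound_trigPoly hX hn hf,
    fun _ _ _ _ _ _ _ _ hCf hCg => TrigGauss.varDist_map_trigPoly_le hX.aemeasurable hn hCf hCg⟩
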